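/- **Setting.** A $q$-level spin system ($q\ge 2$) is $S=(q,V_S,E_S,J_S)$ with $V_S$ a finite set, $E_S\subseteq\mathcal P(V_S)$, local interactions $J_S(e)\colon[q]^e\to\mathbb R_{\ge0}$ for $e\in E_S$, and every spin contained in some $e\in E_S$. Its configurations are $\mathcal C_S=[q]^{V_S}$, its Hamiltonian is $H_S(\vec s)=\sum_{e\in E_S}J_S(e)(\vec s|_e)$, its size is $|S|=\sum_{e\in E_S}q^{|e|}$, and its Boltzmann distribution at $\beta>0$ is $p_{S,\beta}(\vec s)=e^{-\beta H_S(\vec s)}/\sum_{\vec s'\in\mathcal C_S}e^{-\beta H_S(\vec s')}$. A spin model is a set of spin systems with one common $q$, closed under isomorphism (relabelling of spins). A simulation $F\colon S\to T$ consists of a cut-off $\Delta>0$, a shift $\Gamma\in\mathbb R$, an integer $d\ge1$ (degeneracy), a map $P\colon V_T\to V_S^k$ whose components $P^{(i)}(v)$ are pairwise distinct over all $(i,v)$, a map $\mathrm{dec}\colon[q_S]^k\to[q_T]$, and maps $\mathrm{enc}_1,\dots,\mathrm{enc}_m\colon[q_T]\to[q_S]^k$, $m\ge1$, with $\mathrm{dec}\circ\mathrm{enc}_i=\mathrm{id}$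 and $\mathrm{enc}_i(t)\ne\mathrm{enc}_j(t)$ for $i\neq j$ and all $t$, such that for $\mathrm{sim}_i(\vec t)=\{\vec s\in\mathcal C_S:\vec s\circ P=\mathrm{enc}_i\circ\vec t,\ H_S(\vec s)-\Gamma<\Delta\}$: (a) $H_T(\vec t)<\Delta$ implies $|\mathrm{sim}_i(\vec t)|=d$; (b) $H_S(\vec s)-\Gamma=H_T(\vec t)$ for $\vec s\in\mathrm{sim}_i(\vec t)$; (c) $H_S(\vec s)-\Gamma\ge\Delta$ for every $\vec s$ in no $\mathrm{sim}_i(\vec t)$. For a probability distribution $p$ on $\mathcal C_S$ let $p_F$ be the distribution of $\mathrm{dec}\circ\vec s\circ P$ with $\vec s\sim p$; the simulation distribution $p_{F,\beta}$ is $(p_{S,\beta})_F$. Polynomial time refers to programs over the reals with unit-cost arithmetic, comparison, $\exp$ and $\log$; spin systems, configurations and simulations are presented as explicit lists, with functions given by their graphs, and time is polynomial in the number of real parameters of the input. An emulation $\mathrm{Emu}\colon\mathcal M\to\mathcal M'$ is a map taking $T\in\mathcal M'$ and $\delta>0$ to a spin system $S(T,\delta)\in\mathcal M$ and a simulation $F(T,\delta)\colon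 S(T,\delta)\to T$ with cut-off $\delta$, computable in time $\mathrm{poly}(|T|)$, such that for fixed $T$ changing $\delta$ alters neither $V_S$ nor $E_S$ and alters $F$ (apart from its cut-off) only in its shift, and such that $\mathrm{dec}$ and $\mathrm{enc}$ are the same for all $T\in\mathcal M'$ and all $\delta$. The approximate sampling problem $\mathrm{Asp}_{\mathcal M}$ asks, given $S\in\mathcal M$ and $\beta,\epsilon>0$, to sample from a probability distribution $p$ on $\mathcal C_S$ with $\|p_{S,\beta}-p\|<\epsilon$, where $\|\cdot\|$ is the total variation distance. A PTAS reduction $(f,g,\alpha)\colon\mathrm{Asp}_{\mathcal M'}\to\mathrm{Asp}_{\mathcal M}$ consists of polynomial-time computable maps $f(T,\beta,\epsilon)\in\mathcal M\times\mathbb R_{>0}$, $\alpha(\epsilon)>0$, and $g(T,\beta,\vec z,\epsilon)\in\mathcal C_T$, defined for $T\in\mathcal M'$, $\beta,\epsilon>0$ and configurations $\vec z$ of the spin system in $f(T,\beta,\epsilon)$, such that whenever $\vec z$ is sampled from a distribution that solves $f(T,\beta,\epsilon)$ with error parameter $\alpha(\epsilon)$, the distribution of $g(T,\beta,\vec z,\epsilon)$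 solves $(T,\beta)$ with error parameter $\epsilon$. **Theorem.** Let $\mathcal M,\mathcal M'$ be spin models and $\mathrm{Emu}\colon\mathcal M\to\mathcal M'$ an emulation. Then $\mathrm{Emu}$ induces a PTAS reduction $(f,g,\alpha)\colon\mathrm{Asp}_{\mathcal M'}\to\mathrm{Asp}_{\mathcal M}$. More precisely, there is a choice of cut-offs $\delta=\delta(T,\beta,\epsilon)>0$ such that, with $S=S(T,\delta)$ and $F=F(T,\delta)$, $$f(T,\beta,\epsilon)=(S,\beta),\qquad g(T,\beta,\vec z,\epsilon)=\mathrm{dec}\circ\vec z\circ P,\qquad\alpha(\epsilon)=\epsilon/2$$ is a PTAS reduction, and for all $T\in\mathcal M'$ and $\beta,\epsilon>0$ one has $\|p_{F,\beta}-p_{T,\beta}\|<\epsilon/2$ and $\|p_F-p_{F,\beta}\|\le\|p-p_{S,\beta}\|$ for every probability distribution $p$ on $\mathcal C_S$. -/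

import Mathlib

open scoped NNReal

namespace SpinEmulation

/-! ### Spin systems and spin models -/

/-- A `q`-level spin system `(q, V, E, J)`. Spins are labelled by natural numbers, `E` is a set of
subsets of `V`, every `e ∈ E` carries a local interaction `J e : [q]^e → ℝ≥0`, and there are no
isolated spins. The set `[q]` of spin states is `Fin q`. -/
structure SpinSystem (q : ℕ) where
  two_le : 2 ≤ q
  V : Finset ℕ
  E : Finset (Finset ℕ)
  E_subset : ∀ e ∈ E, e ⊆ V
  J : (e : {e : Finset ℕ // e ∈ E}) → ({v : ℕ // v ∈ e.1} → Fin q) → ℝ≥0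
  not_isolated : ∀ v ∈ V, ∃ e ∈ E, v ∈ e

namespace SpinSystem

variable {q : ℕ}

/-- Spin configurations `[q]^V`. -/
abbrev Config (S : SpinSystem q) : Type := {v : ℕ // v ∈ S.V} → Fin q

/-- Restriction of a configuration to a hyperedge. -/
def restrict (S : SpinSystem q) (s : S.Config) (e : {e : Finset ℕ // e ∈ S.E}) :
    {v : ℕ // v ∈ e.1} → Fin q :=
  fun v => s ⟨v.1, S.E_subset e.1 e.2 v.2⟩

/-- The Hamiltonian `H_S(s) = ∑ e ∈ E, J(e)(s|_e)`. -/
noncomputable def hamiltonian (S : SpinSystem q) (s : S.Config) : ℝ :=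
  ∑ e : {e : Finset ℕ // e ∈ S.E}, (S.J e (S.restrict s e) : ℝ)

/-- The size `|S| = ∑ e ∈ E, q ^ |e|`. -/
def size (S : SpinSystem q) : ℕ := ∑ e ∈ S.E, q ^ e.card

/-- The partition function. -/
noncomputable def partitionFunction (S : SpinSystem q) (β : ℝ) : ℝ :=
  ∑ s : S.Config, Real.exp (-β * S.hamiltonian s)

/-- The Boltzmann distribution `p_{S,β}`. -/
noncomputable def boltzmann (S : SpinSystem q) (β : ℝ) (s : S.Config) : ℝ :=
  Real.exp (-β * S.hamiltonian s) / S.partitionFunction β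

/-- `φ` restricts to an isomorphism of spin systems `S ≅ S'`: a bijection from the spins of `S` to
those of `S'` that preserves and reflects hyperedges and matches the local interactions. -/
structure IsIso (S S' : SpinSystem q) (φ : ℕ → ℕ) : Prop where
  bijOn : Set.BijOn φ (S.V : Set ℕ) (S'.V : Set ℕ)
  edges : ∀ e : Finset ℕ, e ⊆ S.V → (e ∈ S.E ↔ e.image φ ∈ S'.E)
  interactions : ∀ (e : Finset ℕ) (he : e ∈ S.E) (he' : e.image φ ∈ S'.E)
    (t : {v : ℕ // v ∈ e.image φ} → Fin q),
    S.J ⟨e, he⟩ (fun v => t ⟨φ v.1, Finset.mem_image_of_mem φ v.2⟩) = S'.J ⟨e.image φ, he'⟩ t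

end SpinSystem

/-- A spin model: a set of spin systems of constant spin type, closed under isomorphism. -/
structure SpinModel where
  q : ℕ
  systems : Set (SpinSystem q)
  iso_closed : ∀ S ∈ systems, ∀ (S' : SpinSystem q) (φ : ℕ → ℕ), S.IsIso S' φ → S' ∈ systems

/-- The type of spin systems belonging to the spin model `M`. -/
abbrev SpinModel.Sys (M : SpinModel) : Type := {S : SpinSystem M.q // S ∈ M.systems}

/-- Positive real numbers. -/
abbrev PosReal : Type := {x : ℝ // 0 < x}

/-! ### Simulations -/

/-- A decoding `dec : [q]^k → [q']` with a nonempty list of encodings `enc_i : [q'] → [q]^k`. -/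
structure Coding (q q' : ℕ) where
  order : ℕ
  card : ℕ
  card_pos : 0 < card
  dec : (Fin order → Fin q) → Fin q'
  enc : Fin card → Fin q' → (Fin order → Fin q)
  dec_enc : ∀ i t, dec (enc i t) = t
  enc_disjoint : ∀ i j t, enc i t = enc j t → i = j

/-- The set `sim_i(t)` of those `s` with `s ∘ P = enc_i ∘ t` and `H_S(s) - Γ < Δ`. -/
def simSet {q q' : ℕ} (S : SpinSystem q) (T : SpinSystem q') (c : Coding q q') (Δ Γ : ℝ)
    (P : {v : ℕ // v ∈ T.V} → Fin c.order → {v : ℕ // v ∈ S.V}) (i : Fin c.card) (t : T.Config) :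
    Set S.Config :=
  {s | (∀ v, (fun j => s (P v j)) = c.enc i (t v)) ∧ S.hamiltonian s - Γ < Δ}

/-- A spin system simulation of type `S → T`. -/
structure Simulation {q q' : ℕ} (S : SpinSystem q) (T : SpinSystem q') where
  cutoff : ℝ
  cutoff_pos : 0 < cutoff
  shift : ℝ
  degeneracy : ℕ
  degeneracy_pos : 0 < degeneracy
  coding : Coding q q'
  phys : {v : ℕ // v ∈ T.V} → Fin coding.order → {v : ℕ // v ∈ S.V}
  phys_disjoint : ∀ v w i j, phys v i = phys w j → i = j ∧ v = w
  constant_degeneracy : ∀ i t, T.hamiltonian t < cutoff →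
    (simSet S T coding cutoff shift phys i t).ncard = degeneracy
  energy_below : ∀ i t, ∀ s ∈ simSet S T coding cutoff shift phys i t,
    S.hamiltonian s - shift = T.hamiltonian t
  energy_above : ∀ s, (∀ i t, s ∉ simSet S T coding cutoff shift phys i t) →
    cutoff ≤ S.hamiltonian s - shift

/-- Decoding of source configurations, `s ↦ dec ∘ s ∘ P`. -/
def Simulation.decode {q q' : ℕ} {S : SpinSystem q} {T : SpinSystem q'} (F : Simulation S T)
    (s : S.Config) : T.Config :=
  fun v => F.coding.dec (fun j => s (F.phys v j))

/-! ### Probability distributions on finite sets -/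

/-- Total variation distance of two functions (probability distributions) on a finite set. -/
noncomputable def tvDist {A : Type} [Fintype A] (p p' : A → ℝ) : ℝ :=
  (1 / 2) * ∑ a, |p a - p' a|

/-- The distribution of `g a` where `a` is distributed according to `p`. -/
def pushforward {A B : Type} [Fintype A] [DecidableEq B] (g : A → B) (p : A → ℝ) (b : B) : ℝ :=
  ∑ a : A with g a = b, p a

/-- The simulation distribution `p_{F,β}`. -/
noncomputable def Simulation.distribution {q q' : ℕ} {S : SpinSystem q} {T : SpinSystem q'}
    (F : Simulation S T) (β : ℝ) : T.Config → ℝ :=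
  pushforward F.decode (S.boltzmann β)

/-! ### Polynomial time computation with real numbers

Programs act on finite binary trees whose leaves are real numbers or the empty list. The cost of
executing a primitive operation is one plus the number of nodes of the tree that it writes, where
every real number counts as a single node; so arithmetic on reals, `exp`, `log` and comparisons
have constant cost, as on a real random access machine, and copying data costs its size. -/

/-- Data: real numbers, the empty list, and pairs. -/
inductive Data : Type
  | real : ℝ → Data
  | nil : Data
  | cons : Data → Data → Data

namespace Data

/-- Number of nodes. -/
def size : Data → ℕ
  | real _ => 1
  | nil => 1
  | cons a b => 1 + a.size + b.size

/-- The list `[x₁, …, xₙ]` as the tree `cons x₁ (cons x₂ (… nil))`. -/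
def ofList : List Data → Data
  | [] => nil
  | x :: l => cons x (ofList l)

end Data

/-- Primitive operations. -/
inductive Op : Type
  | id | nil | const (c : ℚ) | fst | snd | isReal
  | add | sub | mul | div | exp | log | le

open Classical in
/-- Result of a primitive operation; `nil` on arguments of the wrong shape. Tests return `nil` for
`false` and `real 1` for `true`. -/
noncomputable def Op.apply : Op → Data → Data
  | .id, x => x
  | .const c, _ => .real (c : ℝ)
  | .fst, .cons a _ => a
  | .snd, .cons _ b => b
  | .isReal, .real _ => .real 1
  | .add, .cons (.real a) (.real b) => .real (a + b)
  | .sub, .cons (.real a) (.real b) => .real (a - b)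
  | .mul, .cons (.real a) (.real b) => .real (a * b)
  | .div, .cons (.real a) (.real b) => .real (a / b)
  | .exp, .real a => .real (Real.exp a)
  | .log, .real a => .real (Real.log a)
  | .le, .cons (.real a) (.real b) => if a ≤ b then .real 1 else .nil
  | _, _ => .nil

/-- Programs. -/
inductive Prog : Type
  | op (o : Op)
  /-- run both programs on the input and form the pair of the results -/
  | pair (p₁ p₂ : Prog)
  /-- run `p₁`, then run `p₂` on its result -/
  | seq (p₁ p₂ : Prog)
  /-- run `p₁` or `p₂` according to the result of `t` -/
  | ite (t p₁ p₂ : Prog)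
  /-- as long as `t` yields `true` on the current data, apply `p` to it -/
  | loop (t p : Prog)

/-- `Eval p x y n`: on input `x` the program `p` halts with output `y` after `n` steps. -/
inductive Eval : Prog → Data → Data → ℕ → Prop
  | op (o : Op) (x : Data) : Eval (.op o) x (o.apply x) (1 + (o.apply x).size)
  | pair {p₁ p₂ : Prog} {x y₁ y₂ : Data} {n₁ n₂ : ℕ} :
      Eval p₁ x y₁ n₁ → Eval p₂ x y₂ n₂ → Eval (.pair p₁ p₂) x (.cons y₁ y₂) (n₁ + n₂ + 1)
  | seq {p₁ p₂ : Prog} {x y z : Data} {n₁ n₂ : ℕ} :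
      Eval p₁ x y n₁ → Eval p₂ y z n₂ → Eval (.seq p₁ p₂) x z (n₁ + n₂ + 1)
  | ite_true {t p₁ p₂ : Prog} {x b y : Data} {n₁ n₂ : ℕ} :
      Eval t x b n₁ → b ≠ .nil → Eval p₁ x y n₂ → Eval (.ite t p₁ p₂) x y (n₁ + n₂ + 1)
  | ite_false {t p₁ p₂ : Prog} {x y : Data} {n₁ n₂ : ℕ} :
      Eval t x .nil n₁ → Eval p₂ x y n₂ → Eval (.ite t p₁ p₂) x y (n₁ + n₂ + 1)
  | loop_exit {t p : Prog} {x : Data} {n : ℕ} :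
      Eval t x .nil n → Eval (.loop t p) x x (n + 1 + x.size)
  | loop_step {t p : Prog} {x b y z : Data} {n₁ n₂ n₃ : ℕ} :
      Eval t x b n₁ → b ≠ .nil → Eval p x y n₂ → Eval (.loop t p) y z n₃ →
      Eval (.loop t p) x z (n₁ + n₂ + n₃ + 1)

/-- Polynomial time computability of a map given on instances `i : ι`: `inp i x` says that `x` is a
presentation of the `i`-th input, `out i y` that `y` is a presentation of the `i`-th output, and
`size i` is the size of the `i`-th input. One program has to turn every presentation of every input
into a presentation of the corresponding output, in time polynomial in the size. -/
def PolyTimeComputable {ι : Type} (size : ι → ℕ) (inp out : ι → Data → Prop) : Prop :=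
  ∃ (p : Prog) (b : Polynomial ℕ), ∀ (i : ι) (x : Data), inp i x →
    ∃ (y : Data) (n : ℕ), Eval p x y n ∧ out i y ∧ n ≤ b.eval (size i)

/-! ### Presentation of spin systems, configurations and simulations

All objects are listed explicitly: sets by an enumeration without repetitions, functions by their
graphs, tuples in their order. -/

/-- `x` lists presentations (in the sense of `R`) of all elements of `A`, each exactly once. -/
def PresentsAll {A : Type} (R : A → Data → Prop) (x : Data) : Prop :=
  ∃ (l : List A) (ys : List Data), l.Nodup ∧ (∀ a, a ∈ l) ∧ List.Forall₂ R l ys ∧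
    x = Data.ofList ys

/-- `x` is a presentation of the graph of `f`, i.e. of the set of all pairs `(a, f a)`. -/
def PresentsGraph {A B : Type} (R : A → Data → Prop) (R' : B → Data → Prop) (f : A → B)
    (x : Data) : Prop :=
  PresentsAll (fun a y => ∃ u v, R a u ∧ R' (f a) v ∧ y = .cons u v) x

/-- Presentation of real numbers. -/
def PresentsReal (r : ℝ) (x : Data) : Prop := x = .real r

/-- Presentation of a spin label from a finite set of labels. -/
def PresentsSpin {W : Finset ℕ} (v : {v : ℕ // v ∈ W}) (x : Data) : Prop := x = .real (v.1 : ℝ)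

/-- Presentation of a spin state. -/
def PresentsState {q : ℕ} (a : Fin q) (x : Data) : Prop := x = .real (a.1 : ℝ)

/-- Presentation of a `k`-tuple, in order. -/
def PresentsTuple {A : Type} (R : A → Data → Prop) {k : ℕ} (f : Fin k → A) (x : Data) : Prop :=
  ∃ ys : List Data, List.Forall₂ R (List.ofFn f) ys ∧ x = Data.ofList ys

/-- Presentation of a configuration on a finite set of spins. -/
def PresentsConfig {q : ℕ} {W : Finset ℕ} (s : {v : ℕ // v ∈ W} → Fin q) (x : Data) : Prop :=
  PresentsGraph PresentsSpin PresentsState s x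

/-- Presentation of `(q, V, E, J)`: the hyperedges are listed together with the graphs of their
local interactions. -/
def SpinSystem.Presents {q : ℕ} (S : SpinSystem q) (x : Data) : Prop :=
  ∃ xV xE : Data,
    PresentsAll (A := {v : ℕ // v ∈ S.V}) PresentsSpin xV ∧
    PresentsAll (A := {e : Finset ℕ // e ∈ S.E}) (fun e y => ∃ u w : Data,
      PresentsAll (A := {v : ℕ // v ∈ e.1}) PresentsSpin u ∧
      PresentsGraph PresentsConfig (fun r : ℝ≥0 => PresentsReal (r : ℝ)) (S.J e) w ∧
      y = .cons u w) xE ∧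
    x = Data.ofList [.real (q : ℝ), xV, xE]

/-- Presentation of all data `Δ, Γ, d, P, dec, enc` of a simulation. -/
def Simulation.Presents {q q' : ℕ} {S : SpinSystem q} {T : SpinSystem q'} (F : Simulation S T)
    (x : Data) : Prop :=
  ∃ xP xdec xenc : Data,
    PresentsGraph PresentsSpin (PresentsTuple PresentsSpin) F.phys xP ∧
    PresentsGraph (PresentsTuple PresentsState) PresentsState F.coding.dec xdec ∧
    PresentsTuple (PresentsGraph PresentsState (PresentsTuple PresentsState)) F.coding.enc xenc ∧
    x = Data.ofList
      [.real F.cutoff, .real F.shift, .real (F.degeneracy : ℝ), xP, xdec, xenc]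

/-! ### Emulations -/

/-- A spin model emulation of type `M → M'`: a polynomial time algorithm that on input `(T, δ)` with
`T ∈ M'` and `δ > 0` computes a spin system from `M` and a simulation of `T` by it with
cut-off `δ`. -/
structure Emulation (M M' : SpinModel) where
  source : M'.Sys → PosReal → M.Sys
  sim : (T : M'.Sys) → (δ : PosReal) → Simulation (source T δ).1 T.1
  cutoff_eq : ∀ T δ, (sim T δ).cutoff = δ.1
  polytime : PolyTimeComputable (ι := M'.Sys × PosReal)
    (fun i => i.1.1.size)
    (fun i x => ∃ xT : Data, i.1.1.Presents xT ∧ x = .cons xT (.real i.2.1))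
    (fun i y => ∃ yS yF : Data, (source i.1 i.2).1.Presents yS ∧ (sim i.1 i.2).Presents yF ∧
      y = .cons yS yF)
  /-- the interaction hypergraph does not depend on the cut-off -/
  uniform_V : ∀ T δ₁ δ₂, (source T δ₁).1.V = (source T δ₂).1.V
  uniform_E : ∀ T δ₁ δ₂, (source T δ₁).1.E = (source T δ₂).1.E
  /-- apart from the cut-off itself, only the energy shift may depend on the cut-off -/
  uniform_degeneracy : ∀ T δ₁ δ₂, (sim T δ₁).degeneracy = (sim T δ₂).degeneracy
  uniform_phys : ∀ T δ₁ δ₂ v (i : Fin (sim T δ₁).coding.order) (j : Fin (sim T δ₂).coding.order),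
    (i : ℕ) = j → ((sim T δ₁).phys v i : ℕ) = ((sim T δ₂).phys v j : ℕ)
  /-- decoding and encoding depend only on the spin type of `T`, which is constant on `M'` -/
  coding_const : ∀ T₁ T₂ δ₁ δ₂, (sim T₁ δ₁).coding = (sim T₂ δ₂).coding

/-! ### Approximate sampling and PTAS reductions -/

/-- Instances `(S, β)` of the approximate sampling problem of `M`. -/
abbrev AspInstance (M : SpinModel) : Type := M.Sys × PosReal

/-- `p` is an admissible output distribution for the instance `(S, β)` of the approximate sampling
problem with error parameter `ε`: a probability distribution on the configurations of `S` with
`‖p_{S,β} - p‖ < ε`. -/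
def SolvesAsp {M : SpinModel} (I : AspInstance M) (ε : PosReal) (p : I.1.1.Config → ℝ) : Prop :=
  p ∈ stdSimplex ℝ I.1.1.Config ∧ tvDist (I.1.1.boltzmann I.2.1) p < ε.1

/-- `(f, g, α)` is a PTAS reduction from approximate sampling for `M'` to approximate sampling
for `M`. -/
structure IsPTASReduction (M' M : SpinModel)
    (f : AspInstance M' → PosReal → AspInstance M)
    (g : (I : AspInstance M') → (ε : PosReal) → (f I ε).1.1.Config → I.1.1.Config)
    (α : PosReal → PosReal) : Prop where
  f_polytime : PolyTimeComputable (ι := AspInstance M' × PosReal)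
    (fun i => i.1.1.1.size)
    (fun i x => ∃ xT : Data, i.1.1.1.Presents xT ∧
      x = Data.ofList [xT, .real i.1.2.1, .real i.2.1])
    (fun i y => ∃ yS : Data, (f i.1 i.2).1.1.Presents yS ∧
      y = Data.ofList [yS, .real (f i.1 i.2).2.1])
  g_polytime : PolyTimeComputable
    (ι := Σ i : AspInstance M' × PosReal, (f i.1 i.2).1.1.Config)
    (fun i => i.1.1.1.1.size + (f i.1.1 i.1.2).1.1.V.card)
    (fun i x => ∃ xT xz : Data, i.1.1.1.1.Presents xT ∧ PresentsConfig i.2 xz ∧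
      x = Data.ofList [xT, .real i.1.1.2.1, xz, .real i.1.2.1])
    (fun i y => PresentsConfig (g i.1.1 i.1.2 i.2) y)
  α_polytime : PolyTimeComputable (ι := PosReal) (fun _ => 1)
    (fun ε x => x = .real ε.1) (fun ε y => y = .real (α ε).1)
  correct : ∀ (I : AspInstance M') (ε : PosReal) (p : (f I ε).1.1.Config → ℝ),
    SolvesAsp (f I ε) (α ε) p → SolvesAsp I ε (pushforward (g I ε) p)

/-- The instance map `(T, β, ε) ↦ (S, β)`, where `S` is the spin system that the emulation computes
for `T` with cut-off `δ(T, β, ε)`. -/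
def Emulation.instanceMap {M M' : SpinModel} (Emu : Emulation M M')
    (δ : AspInstance M' → PosReal → PosReal) (I : AspInstance M') (ε : PosReal) : AspInstance M :=
  (Emu.source I.1 (δ I ε), I.2)

/-- The sample map `z ↦ dec ∘ z ∘ P` of the simulation computed with cut-off `δ(T, β, ε)`. -/
def Emulation.sampleMap {M M' : SpinModel} (Emu : Emulation M M')
    (δ : AspInstance M' → PosReal → PosReal) (I : AspInstance M') (ε : PosReal) :
    (Emu.instanceMap δ I ε).1.1.Config → I.1.1.Config :=
  (Emu.sim I.1 (δ I ε)).decode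

/-- The error map `ε ↦ ε / 2`. -/
noncomputable def halfError (ε : PosReal) : PosReal := ⟨ε.1 / 2, half_pos ε.2⟩

end SpinEmulation

namespace SpinEmulation

/-! ### Closure properties of polynomial time computation -/

/-! Analytic part. Let `n` be the number of spins of `S`, let `H` bound `H_T`, and take a cut-off `Δ
> H`. Then every target configuration lies below the cut-off, and all have the same number `N` of
simulating source configurations, each of energy `H_T(t) + Γ`. The shift cancels on normalizing, so
the simulation distribution is proportional to `N e^{-βH_T(t)} + r(t)`, where `r` collects the
source configurations that simulate nothing. There are at most `q^n` of those, each of weight at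
most `e^{-βΔ}`, while the main part has mass at least `e^{-βH}`. Adding mass `R` to a measure of
mass `W` moves its normalization by at most `R / W` (`tvDist_normalize_le`), so the error is at most
`q^n e^{-β(Δ-H)}` (`tvDist_distribution_le`). The choice `Δ = H + (n log q + log(1 + 2/ε))/β` turns
this into `ε/(ε+2) < ε/2`. Push-forward contracts total variation (`tvDist_pushforward_le`), and the
triangle inequality adds the two halves of `ε`.

Computational part. For `H` the sum of all tabulated interaction values is used, which is read off
the presentation of `T`. The number `n` is known only after the emulation has run, but it does not
depend on the cut-off. So the emulation is run with cut-off `1`, the spins are counted, and it is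
run again with the right cut-off (`run_samplingCutoff`). Decoding a sample is table lookup. Running
times are controlled by `PolyFun`, a class of total functions on data closed under composition,
pairing, case distinction and folds over lists whose accumulator grows only additively. -/

theorem Data.size_pos (x : Data) : 0 < x.size := by
  cases x <;> simp [Data.size]

/-- Writing is charged by size, so running time bounds output size. This is what makes polynomial
time closed under composition. -/
theorem Eval.size_le {p : Prog} {x y : Data} {n : ℕ} (h : Eval p x y n) : y.size ≤ n := by
  induction h <;> (try simp only [Data.size]) <;> omega

theorem eval_mono (b : Polynomial ℕ) : Monotone fun n : ℕ => b.eval n := by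
  intro m n h
  simp only [Polynomial.eval_eq_sum_range]
  gcongr

/-- A total function on data that is computable in time polynomial in the number of nodes. -/
def PolyFun (F : Data → Data) : Prop :=
  ∃ (p : Prog) (b : Polynomial ℕ), ∀ x, ∃ n, Eval p x (F x) n ∧ n ≤ b.eval x.size

namespace PolyFun

theorem size_le {F : Data → Data} (h : PolyFun F) :
    ∃ b : Polynomial ℕ, ∀ x, (F x).size ≤ b.eval x.size := by
  obtain ⟨p, b, h⟩ := h
  refine ⟨b, fun x => ?_⟩
  obtain ⟨n, h1, h2⟩ := h x
  exact h1.size_le.trans h2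

theorem op_size_le (o : Op) (x : Data) : (o.apply x).size ≤ x.size + 1 := by
  have := x.size_pos
  unfold Op.apply
  split
  case h_12 => split <;> simp [Data.size]
  all_goals try simp only [Data.size]
  all_goals omega

theorem op (o : Op) : PolyFun o.apply := by
  refine ⟨.op o, Polynomial.X + 2, fun x => ⟨_, .op o x, ?_⟩⟩
  have := op_size_le o x
  simp
  omega

theorem comp {G F : Data → Data} (hG : PolyFun G) (hF : PolyFun F) :
    PolyFun fun x => G (F x) := by
  obtain ⟨p, b, hp⟩ := hF
  obtain ⟨q, c, hq⟩ := hG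
  refine ⟨.seq p q, b + c.comp b + 1, fun x => ?_⟩
  obtain ⟨n, h1, h2⟩ := hp x
  obtain ⟨m, h3, h4⟩ := hq (F x)
  refine ⟨_, .seq h1 h3, ?_⟩
  have := eval_mono c (h1.size_le.trans h2)
  simp only [Polynomial.eval_add, Polynomial.eval_comp, Polynomial.eval_one] at this ⊢
  omega

theorem pair {F G : Data → Data} (hF : PolyFun F) (hG : PolyFun G) :
    PolyFun fun x => .cons (F x) (G x) := by
  obtain ⟨p, b, hp⟩ := hF
  obtain ⟨q, c, hq⟩ := hG
  refine ⟨.pair p q, b + c + 1, fun x => ?_⟩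
  obtain ⟨n, h1, h2⟩ := hp x
  obtain ⟨m, h3, h4⟩ := hq x
  refine ⟨_, .pair h1 h3, ?_⟩
  simp only [Polynomial.eval_add, Polynomial.eval_one]
  omega

protected theorem id : PolyFun fun x => x := op .id

end PolyFun

namespace Data

/-- Case distinction on a truth value. -/
def cond : Data → Data → Data → Data
  | .nil, _, b => b
  | .real _, a, _ => a
  | .cons _ _, a, _ => a

@[simp] theorem cond_nil (a b : Data) : cond .nil a b = b := rfl

theorem cond_of_ne {t : Data} (h : t ≠ .nil) (a b : Data) : cond t a b = a := by
  cases t <;> simp_all [cond]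

/-- First component. -/
def fst : Data → Data
  | .cons a _ => a
  | _ => .nil

/-- Second component. -/
def snd : Data → Data
  | .cons _ b => b
  | _ => .nil

@[simp] theorem fst_cons (a b : Data) : (Data.cons a b).fst = a := rfl
@[simp] theorem snd_cons (a b : Data) : (Data.cons a b).snd = b := rfl

/-- The list of entries of a tree. -/
def toList : Data → List Data
  | .cons a b => a :: b.toList
  | _ => []

@[simp] theorem toList_ofList (l : List Data) : (ofList l).toList = l := by
  induction l with
  | nil => rfl
  | cons a l ih => simp [ofList, toList, ih]

end Data

namespace PolyFun

theorem fst {F : Data → Data} (hF : PolyFun F) : PolyFun fun x => (F x).fst := by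
  refine comp (G := Data.fst) ?_ hF
  convert op .fst using 1
  funext x
  cases x <;> rfl

theorem snd {F : Data → Data} (hF : PolyFun F) : PolyFun fun x => (F x).snd := by
  refine comp (G := Data.snd) ?_ hF
  convert op .snd using 1
  funext x
  cases x <;> rfl

theorem nil : PolyFun fun _ => .nil := by
  convert op .nil using 1
  funext x
  cases x <;> rfl

theorem const (c : ℚ) : PolyFun fun _ => .real c := by
  convert op (.const c) using 1
  funext x
  simp [Op.apply]

theorem cond {T F G : Data → Data} (hT : PolyFun T) (hF : PolyFun F) (hG : PolyFun G) :
    PolyFun fun x => (T x).cond (F x) (G x) := by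
  obtain ⟨p, b, hp⟩ := hF
  obtain ⟨q, c, hq⟩ := hG
  obtain ⟨t, d, ht⟩ := hT
  refine ⟨.ite t p q, b + c + d + 1, fun x => ?_⟩
  obtain ⟨n, h1, h2⟩ := hp x
  obtain ⟨m, h3, h4⟩ := hq x
  obtain ⟨k, h5, h6⟩ := ht x
  simp only [Polynomial.eval_add, Polynomial.eval_one]
  by_cases h : T x = .nil
  · rw [h] at h5 ⊢
    exact ⟨_, .ite_false h5 h3, by omega⟩
  · rw [Data.cond_of_ne h]
    exact ⟨_, .ite_true h5 h h1, by omega⟩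

end PolyFun

/-! ### Folds over lists as loops -/

/-- The list of entries of a tree, as a tree; used as the test of loops over lists. -/
noncomputable def nonempty (l : Data) : Data := (Op.isReal.apply l).cond .nil l

@[simp] theorem nonempty_cons (a b : Data) : nonempty (.cons a b) = .cons a b := rfl

theorem PolyFun.nonempty {F : Data → Data} (hF : PolyFun F) :
    PolyFun fun x => nonempty (F x) :=
  comp (G := SpinEmulation.nonempty) (cond (op .isReal) nil .id) hF

/-- The loop state `(env, (acc, list))` after processing one list entry. -/
def foldStep (step : Data → Data) (x : Data) : Data :=
  .cons x.fst (.cons (step (.cons x.fst (.cons x.snd.fst x.snd.snd.fst))) x.snd.snd.snd)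

/-- The fold of `step`, called on `(env, (acc, entry))`, over the entries of a list. -/
def foldData (step : Data → Data) (env acc l : Data) : Data :=
  l.toList.foldl (fun a y => step (.cons env (.cons a y))) acc

/-- `W` bounds the environment together with the unread list; `K` bounds the accumulator plus all it
can still gain, at most `c.eval W` per remaining node. Both bounds survive an iteration, so every
loop state has at most `W + K + 2` nodes and each round, including the exit, has a uniform cost. -/
theorem loop_fold {step : Data → Data} {t p : Prog} {bt bp c : Polynomial ℕ}
    (ht : ∀ x, ∃ n, Eval t x (nonempty x.snd.snd) n ∧ n ≤ bt.eval x.size)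
    (hp : ∀ x, ∃ n, Eval p x (foldStep step x) n ∧ n ≤ bp.eval x.size)
    (hc : ∀ env a y, (step (.cons env (.cons a y))).size ≤ a.size + c.eval (env.size + y.size))
    (env : Data) (W K : ℕ) (l : Data) :
    ∀ a : Data, env.size + l.size ≤ W → a.size + l.size * c.eval W ≤ K →
    ∃ z n, Eval (.loop t p) (.cons env (.cons a l)) z n ∧ z.snd.fst = foldData step env a l ∧
      n ≤ l.size * (bt.eval (W + K + 2) + bp.eval (W + K + 2) + (W + K + 3)) := by
  -- A list may end in `nil` or, for malformed data, in a real number; the loop stops in the same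
  -- way on both.
  have exit : ∀ l : Data, nonempty l = .nil → ∀ a : Data,
      env.size + l.size ≤ W → a.size + l.size * c.eval W ≤ K →
      ∃ n, Eval (.loop t p) (.cons env (.cons a l)) (.cons env (.cons a l)) n ∧
        n ≤ l.size * (bt.eval (W + K + 2) + bp.eval (W + K + 2) + (W + K + 3)) := by
    intro l hl a hW hK
    obtain ⟨n, h1, h2⟩ := ht (.cons env (.cons a l))
    simp only [Data.snd_cons, hl] at h1
    refine ⟨_, .loop_exit h1, ?_⟩
    have hs : (Data.cons env (.cons a l)).size ≤ W + K + 2 := by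
      simp only [Data.size]
      have := Nat.zero_le (l.size * c.eval W)
      omega
    have h3 := eval_mono bt hs
    have h4 := Nat.le_mul_of_pos_left
      (bt.eval (W + K + 2) + bp.eval (W + K + 2) + (W + K + 3)) l.size_pos
    simp only at h3
    omega
  induction l with
  | real r =>
    intro a hW hK
    obtain ⟨n, h1, h2⟩ := exit (.real r) rfl a hW hK
    exact ⟨_, n, h1, rfl, h2⟩
  | nil =>
    intro a hW hK
    obtain ⟨n, h1, h2⟩ := exit .nil rfl a hW hK
    exact ⟨_, n, h1, rfl, h2⟩
  | cons y l _ ih =>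
    intro a hW hK
    simp only [Data.size] at hW hK
    have hs : (Data.cons env (.cons a (.cons y l))).size ≤ W + K + 2 := by
      simp only [Data.size]
      have := Nat.zero_le ((1 + y.size + l.size) * c.eval W)
      omega
    obtain ⟨n, h1, h2⟩ := ht (.cons env (.cons a (.cons y l)))
    obtain ⟨m, h3, h4⟩ := hp (.cons env (.cons a (.cons y l)))
    have h5 := hc env a y
    have h6 : c.eval (env.size + y.size) ≤ c.eval W := eval_mono c (by omega)
    simp only [foldStep, Data.fst_cons, Data.snd_cons] at h3
    have h7 : (step (.cons env (.cons a y))).size + l.size * c.eval W ≤ K := by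
      have : (1 + y.size + l.size) * c.eval W =
          c.eval W + y.size * c.eval W + l.size * c.eval W := by ring
      have := Nat.zero_le (y.size * c.eval W)
      omega
    obtain ⟨z, k, h8, h9, h10⟩ := ih (step (.cons env (.cons a y))) (by omega) h7
    refine ⟨z, _, .loop_step h1 (by simp) h3 h8, h9, ?_⟩
    have h11 := eval_mono bt hs
    have h12 := eval_mono bp hs
    simp only at h11 h12
    simp only [Data.size]
    generalize bt.eval (W + K + 2) = B at *
    generalize bp.eval (W + K + 2) = C at *
    have : (1 + y.size + l.size) * (B + C + (W + K + 3)) = (B + C + (W + K + 3)) +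
      y.size * (B + C + (W + K + 3)) + l.size * (B + C + (W + K + 3)) := by ring
    have := Nat.zero_le (y.size * (B + C + (W + K + 3)))
    omega

/-- The growth condition `hc` bounds the increment by the environment and the entry alone.
Polynomial time of `step` would not suffice: a step that doubles the accumulator produces
exponential size. -/
theorem PolyFun.fold {step E A L : Data → Data} (hstep : PolyFun step) (hE : PolyFun E)
    (hA : PolyFun A) (hL : PolyFun L)
    (hc : ∃ c : Polynomial ℕ, ∀ env a y,
      (step (.cons env (.cons a y))).size ≤ a.size + c.eval (env.size + y.size)) :
    PolyFun fun x => foldData step (E x) (A x) (L x) := by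
  suffices h : PolyFun fun x => foldData step x.fst x.snd.fst x.snd.snd from
    h.comp (hE.pair (hA.pair hL))
  obtain ⟨c, hc⟩ := hc
  obtain ⟨t, bt, ht⟩ : PolyFun fun x => SpinEmulation.nonempty x.snd.snd :=
    PolyFun.id.snd.snd.nonempty
  obtain ⟨p, bp, hp⟩ : PolyFun (foldStep step) :=
    PolyFun.id.fst.pair ((hstep.comp (PolyFun.id.fst.pair (PolyFun.id.snd.fst.pair
      PolyFun.id.snd.snd.fst))).pair PolyFun.id.snd.snd.snd)
  -- on arguments that are not of the form `(env, (acc, list))` the components are `nil`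
  obtain ⟨q, bq, hq⟩ : PolyFun fun x => .cons x.fst (.cons x.snd.fst x.snd.snd) :=
    PolyFun.id.fst.pair (PolyFun.id.snd.fst.pair PolyFun.id.snd.snd)
  obtain ⟨o, bo, ho⟩ : PolyFun fun x => x.snd.fst := PolyFun.id.snd.fst
  -- `bq` bounds the initial loop state, hence serves as `W`; `K` adds the total growth of the
  -- accumulator, and `R` is the resulting bound on the loop's running time.
  let K : Polynomial ℕ := bq + bq * c.comp bq
  let R : Polynomial ℕ := bq * (bt.comp (bq + K + 2) + bp.comp (bq + K + 2) + (bq + K + 3))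
  refine ⟨.seq q (.seq (.loop t p) o), bq + (R + bo.comp R + 1) + 1, fun x => ?_⟩
  obtain ⟨n, h1, h2⟩ := hq x
  have hs := h1.size_le.trans h2
  simp only [Data.size] at hs
  have hK : x.snd.fst.size + x.snd.snd.size * c.eval (bq.eval x.size) ≤ K.eval x.size := by
    simp only [K, Polynomial.eval_add, Polynomial.eval_mul, Polynomial.eval_comp]
    gcongr <;> omega
  obtain ⟨z, m, h3, h4, h5⟩ := loop_fold ht hp hc x.fst (bq.eval x.size) (K.eval x.size)
    x.snd.snd x.snd.fst (by omega) hK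
  obtain ⟨k, h6, h7⟩ := ho z
  simp only [h4] at h6
  have h8 : m ≤ R.eval x.size := by
    refine h5.trans ?_
    simp only [R, Polynomial.eval_add, Polynomial.eval_mul, Polynomial.eval_comp,
      Polynomial.eval_ofNat]
    gcongr
    omega
  have h9 := eval_mono bo (h3.size_le.trans h8)
  refine ⟨_, .seq h1 (.seq h3 h6), ?_⟩
  simp only [Polynomial.eval_add, Polynomial.eval_comp, Polynomial.eval_one] at h9 ⊢
  omega

/-! ### Composition of algorithms on presentations -/

namespace PolyTimeComputable

variable {ι κ : Type} {size : ι → ℕ} {inp mid out : ι → Data → Prop}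

/-- Costs of `PolyFun` steps are polynomial in the data at hand, not in the instance. Carrying a
size bound along with the output lets such steps follow an arbitrary algorithm. -/
theorem bounded (h : PolyTimeComputable size inp out) : ∃ c : Polynomial ℕ,
    PolyTimeComputable size inp fun i y => out i y ∧ y.size ≤ c.eval (size i) := by
  obtain ⟨p, b, h⟩ := h
  refine ⟨b, p, b, fun i x hx => ?_⟩
  obtain ⟨y, n, h1, h2, h3⟩ := h i x hx
  exact ⟨y, n, h1, ⟨h2, h1.size_le.trans h3⟩, h3⟩

theorem reindex (h : PolyTimeComputable size inp out) (φ : κ → ι) (size' : κ → ℕ)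
    (hφ : ∀ k, size (φ k) ≤ size' k) :
    PolyTimeComputable size' (fun k => inp (φ k)) (fun k => out (φ k)) := by
  obtain ⟨p, b, h⟩ := h
  refine ⟨p, b, fun k x hx => ?_⟩
  obtain ⟨y, n, h1, h2, h3⟩ := h (φ k) x hx
  exact ⟨y, n, h1, h2, h3.trans (eval_mono b (hφ k))⟩

theorem comp (h₂ : PolyTimeComputable size mid out) (h₁ : PolyTimeComputable size inp mid) :
    PolyTimeComputable size inp out := by
  obtain ⟨p, b, hp⟩ := h₁
  obtain ⟨q, c, hq⟩ := h₂
  refine ⟨.seq p q, b + c + 1, fun i x hx => ?_⟩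
  obtain ⟨y, n, h1, h2, h3⟩ := hp i x hx
  obtain ⟨z, m, h4, h5, h6⟩ := hq i y h2
  refine ⟨z, _, .seq h1 h4, h5, ?_⟩
  simp only [Polynomial.eval_add, Polynomial.eval_one]
  omega

theorem of_polyFun {F : Data → Data} (hF : PolyFun F) (c : Polynomial ℕ)
    (hc : ∀ i x, inp i x → x.size ≤ c.eval (size i)) (h : ∀ i x, inp i x → out i (F x)) :
    PolyTimeComputable size inp out := by
  obtain ⟨p, b, hp⟩ := hF
  refine ⟨p, b.comp c, fun i x hx => ?_⟩
  obtain ⟨n, h1, h2⟩ := hp x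
  refine ⟨_, n, h1, h i x hx, ?_⟩
  rw [Polynomial.eval_comp]
  exact h2.trans (eval_mono b (hc i x hx))

/-- Running an algorithm on a part of the data while keeping all of it. -/
theorem keep {F : Data → Data} (h : PolyTimeComputable size mid out) (hF : PolyFun F)
    (c : Polynomial ℕ) (hc : ∀ i x, inp i x → x.size ≤ c.eval (size i))
    (hm : ∀ i x, inp i x → mid i (F x)) :
    PolyTimeComputable size inp fun i y => ∃ x z, inp i x ∧ out i z ∧ y = .cons x z := by
  obtain ⟨p, b, hp⟩ := h.comp (of_polyFun hF c hc hm)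
  obtain ⟨q, d, hq⟩ := PolyFun.id
  refine ⟨.pair q p, d.comp c + b + 1, fun i x hx => ?_⟩
  obtain ⟨y, n, h1, h2, h3⟩ := hp i x hx
  obtain ⟨m, h4, h5⟩ := hq x
  refine ⟨_, _, .pair h4 h1, ⟨x, y, hx, h2, rfl⟩, ?_⟩
  have := eval_mono d (hc i x hx)
  simp only [Polynomial.eval_add, Polynomial.eval_comp, Polynomial.eval_one] at this ⊢
  omega

end PolyTimeComputable

/-! ### Algorithms on lists -/

namespace Data

theorem size_fst_add_size_snd_le (x : Data) : x.fst.size + x.snd.size ≤ x.size + 1 := by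
  have := x.size_pos
  cases x <;> simp only [fst, snd, size] at * <;> omega

theorem size_snd_le (x : Data) : x.snd.size ≤ x.size := by
  have := x.size_fst_add_size_snd_le
  have := x.fst.size_pos
  omega

theorem size_cond_le (t a b : Data) : (cond t a b).size ≤ max a.size b.size := by
  cases t <;> simp [cond]

/-- Sum of the values of `w` on the entries of a list. -/
noncomputable def sum (w : Data → Data) (l : Data) : Data :=
  foldData (fun x => Op.add.apply (.cons x.snd.fst (w x.snd.snd))) .nil (.real 0) l

theorem sum_eq {A : Type} {w : Data → Data} {f : A → ℝ} {l : List A} {ys : List Data}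
    (h : List.Forall₂ (fun a y => w y = .real (f a)) l ys) :
    sum w (ofList ys) = .real (l.map f).sum := by
  suffices H : ∀ r : ℝ, ys.foldl (fun a y => Op.add.apply (.cons a (w y))) (.real r) =
      .real (r + (l.map f).sum) by
    simpa [sum, foldData] using H 0
  induction h with
  | nil => simp
  | cons h _ ih =>
    intro r
    simp only [List.foldl_cons, h, List.map_cons, List.sum_cons, ← add_assoc]
    exact ih _

/-- Test for equality of real numbers. -/
noncomputable def realEq (x : Data) : Data :=
  (Op.le.apply (.cons x.fst x.snd)).cond (Op.le.apply (.cons x.snd x.fst)) .nil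

theorem realEq_ne_nil (r s : ℝ) : realEq (.cons (.real r) (.real s)) ≠ .nil ↔ r = s := by
  by_cases h₁ : r ≤ s <;> by_cases h₂ : s ≤ r <;> simp [realEq, Op.apply, h₁, h₂, cond]
  · exact le_antisymm h₁ h₂
  · rintro rfl; exact h₂ le_rfl
  · rintro rfl; exact h₁ le_rfl
  · rintro rfl; exact h₁ le_rfl

/-- Test for equality of lists of real numbers of the same length. -/
noncomputable def listEq (x : Data) : Data :=
  (foldData (fun x => .cons ((realEq (.cons x.snd.snd x.snd.fst.snd.fst)).cond x.snd.fst.fst .nil)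
    x.snd.fst.snd.snd) .nil (.cons (.real 1) x.snd) x.fst).fst

theorem listEq_ne_nil {ys zs : List ℝ} (h : ys.length = zs.length) :
    listEq (.cons (ofList (ys.map .real)) (ofList (zs.map .real))) ≠ .nil ↔ ys = zs := by
  -- The accumulator pairs a flag with the unread rest of the second list; the induction needs an
  -- arbitrary flag, since a mismatch clears it for good.
  suffices H : ∀ flag : Data,
      ((ys.map Data.real).foldl (fun a y => Data.cons ((realEq (.cons y a.snd.fst)).cond a.fst .nil)
        a.snd.snd) (.cons flag (ofList (zs.map .real)))).fst ≠ .nil ↔ flag ≠ .nil ∧ ys = zs by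
    simpa [listEq, foldData] using H (.real 1)
  induction ys generalizing zs with
  | nil =>
    intro flag
    have : zs = [] := List.length_eq_zero_iff.mp h.symm
    subst this
    simp
  | cons y ys ih =>
    intro flag
    match zs, h with
    | z :: zs, h =>
      have := ih (zs := zs) (by simpa using h)
        ((realEq (.cons (.real y) (.real z))).cond flag .nil)
      simp only [List.map_cons, List.foldl_cons, ofList, fst_cons, snd_cons]
      rw [this]
      by_cases hyz : y = z
      · rw [cond_of_ne ((realEq_ne_nil y z).mpr hyz)]
        simp [hyz]
      · have : realEq (.cons (.real y) (.real z)) = .nil := by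
          simpa using (realEq_ne_nil y z).not.mpr hyz
        simp [this, hyz]

/-- Value of a key in a list of pairs, where keys are compared by `eq`. -/
def lookup (eq : Data → Data) (key l : Data) : Data :=
  foldData (fun x => (eq (.cons x.fst x.snd.snd.fst)).cond x.snd.snd.snd x.snd.fst) key .nil l

theorem lookup_spec {A B : Type} {R : A → Data → Prop} {R' : B → Data → Prop} {f : A → B}
    {eq : Data → Data} {x key : Data} {a : A} (hx : PresentsGraph R R' f x)
    (heq : ∀ a' u, R a' u → (eq (.cons key u) ≠ .nil ↔ a = a')) :
    R' (f a) (lookup eq key x) := by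
  obtain ⟨l, ys, -, hl, hys, rfl⟩ := hx
  -- Invariant of the scan: the key is still to come, or the accumulator already presents its value.
  -- The default `nil` is harmless because the graph contains every key.
  suffices H : ∀ acc : Data, (a ∈ l ∨ R' (f a) acc) → R' (f a)
      (ys.foldl (fun b y => (eq (.cons key y.fst)).cond y.snd b) acc) by
    simpa [lookup, foldData] using H .nil (.inl (hl a))
  clear hl
  induction hys with
  | nil => intro acc h; simpa using h
  | @cons a' y l ys h _ ih =>
    intro acc hacc
    obtain ⟨u, v, hu, hv, rfl⟩ := h
    refine ih _ ?_
    by_cases haa : a = a'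
    · right
      simp only [fst_cons, snd_cons]
      rw [cond_of_ne ((heq a' u hu).mpr haa), haa]
      exact hv
    · have : eq (.cons key u) = .nil := by simpa using (heq a' u hu).not.mpr haa
      simpa [this, haa] using hacc

/-- The list of values `g (env, y)`, where `y` runs through the entries of a list. -/
def map (g : Data → Data) (env l : Data) : Data :=
  foldData (fun x => .cons x.snd.snd x.snd.fst) .nil .nil
    (foldData (fun x => .cons (g (.cons x.fst x.snd.snd)) x.snd.fst) env .nil l)

/-- Consing onto the accumulator reverses the list, which is why `map` ends with a second fold that
only reverses. -/
theorem foldData_cons (g : Data → Data) (env : Data) (l : List Data) (acc : List Data) :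
    l.foldl (fun a y => Data.cons (g (.cons env y)) a) (ofList acc) =
      ofList ((l.map fun y => g (.cons env y)).reverse ++ acc) := by
  induction l generalizing acc with
  | nil => simp
  | cons y l ih =>
    have := ih (g (.cons env y) :: acc)
    simpa [ofList] using this

theorem map_ofList (g : Data → Data) (env : Data) (l : List Data) :
    map g env (ofList l) = ofList (l.map fun y => g (.cons env y)) := by
  have h := foldData_cons g env l []
  have h' := foldData_cons Data.snd .nil (l.map fun y => g (.cons env y)).reverse []
  simp only [snd_cons, List.append_nil, List.map_id', List.reverse_reverse, ofList] at h h'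
  simp only [map, foldData, toList_ofList, fst_cons, snd_cons, h, h']

end Data

namespace PolyFun

theorem op_comp (o : Op) {F : Data → Data} (hF : PolyFun F) : PolyFun fun x => o.apply (F x) :=
  (op o).comp hF

theorem sum {w L : Data → Data} (hw : PolyFun w) (hL : PolyFun L) :
    PolyFun fun x => (L x).sum w := by
  refine fold (op_comp .add (PolyFun.id.snd.fst.pair (hw.comp PolyFun.id.snd.snd))) nil
    (by simpa using const 0) hL ⟨1, fun env a y => ?_⟩
  -- Addition always returns a leaf, whatever its argument, so the accumulator cannot grow.
  suffices h : ∀ z, (Op.add.apply z).size ≤ 1 from (h _).trans (by simp)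
  intro z
  unfold Op.apply
  split <;> simp_all [Data.size]

theorem realEq : PolyFun Data.realEq :=
  cond (op_comp .le (PolyFun.id.fst.pair PolyFun.id.snd))
    (op_comp .le (PolyFun.id.snd.pair PolyFun.id.fst)) nil

theorem listEq : PolyFun Data.listEq := by
  refine (fold ?_ nil (by simpa using (const 1).pair PolyFun.id.snd)
    PolyFun.id.fst ⟨3, fun env a y => ?_⟩).fst
  · exact ((realEq.comp (PolyFun.id.snd.snd.pair PolyFun.id.snd.fst.snd.fst)).cond
      PolyFun.id.snd.fst.fst nil).pair PolyFun.id.snd.fst.snd.snd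
  · simp only [Data.snd_cons, Data.fst_cons, Data.size]
    have h1 := Data.size_cond_le (Data.realEq (.cons y a.snd.fst)) a.fst .nil
    have h2 := a.size_fst_add_size_snd_le
    have h3 := a.snd.size_snd_le
    have h4 := a.fst.size_pos
    simp only [Data.size] at h1
    simp
    omega

theorem lookup {eq K L : Data → Data} (heq : PolyFun eq) (hK : PolyFun K) (hL : PolyFun L) :
    PolyFun fun x => Data.lookup eq (K x) (L x) := by
  refine fold ((heq.comp (PolyFun.id.fst.pair PolyFun.id.snd.snd.fst)).cond
    PolyFun.id.snd.snd.snd PolyFun.id.snd.fst) hK nil hL ⟨Polynomial.X, fun env a y => ?_⟩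
  simp only [Data.snd_cons, Data.fst_cons, Polynomial.eval_X]
  refine (Data.size_cond_le _ _ _).trans ?_
  have := y.size_snd_le
  omega

theorem map {g E L : Data → Data} (hg : PolyFun g) (hE : PolyFun E) (hL : PolyFun L) :
    PolyFun fun x => Data.map g (E x) (L x) := by
  obtain ⟨c, hc⟩ := hg.size_le
  refine fold (PolyFun.id.snd.snd.pair PolyFun.id.snd.fst) nil nil
    (fold ((hg.comp (PolyFun.id.fst.pair PolyFun.id.snd.snd)).pair PolyFun.id.snd.fst) hE nil hL
      ⟨1 + c.comp (1 + Polynomial.X), fun env a y => ?_⟩)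
    ⟨1 + Polynomial.X, fun env a y => ?_⟩
  · have := hc (.cons env y)
    simp only [Data.snd_cons, Data.fst_cons, Data.size, Polynomial.eval_add, Polynomial.eval_comp,
      Polynomial.eval_one, Polynomial.eval_X] at this ⊢
    rw [← add_assoc 1 env.size]
    omega
  · simp only [Data.snd_cons, Data.fst_cons, Data.size, Polynomial.eval_add,
      Polynomial.eval_one, Polynomial.eval_X]
    omega

end PolyFun

/-! ### Sizes of presentations -/

theorem Data.size_ofList_le {B : ℕ} {ys : List Data} (h : ∀ y ∈ ys, y.size ≤ B) :
    (ofList ys).size ≤ 1 + ys.length * (B + 1) := by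
  induction ys with
  | nil => simp [ofList, size]
  | cons y ys ih =>
    have h1 := h y (by simp)
    have h2 := ih fun z hz => h z (by simp [hz])
    simp only [ofList, size, List.length_cons, add_mul]
    omega

/-- The enumeration has no repetitions, so its length is at most the cardinality. -/
theorem PresentsAll.size_le {A : Type} [Fintype A] {R : A → Data → Prop} {B : ℕ} {x : Data}
    (hx : PresentsAll R x) (hR : ∀ a y, R a y → y.size ≤ B) :
    x.size ≤ 1 + Fintype.card A * (B + 1) := by
  obtain ⟨l, ys, hl, -, h, rfl⟩ := hx
  have h1 : ys.length ≤ Fintype.card A := h.length_eq ▸ hl.length_le_card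
  refine (Data.size_ofList_le (B := B) fun y hy => ?_).trans (by gcongr)
  clear hl h1
  induction h with
  | nil => simp at hy
  | cons h _ ih =>
    rcases List.mem_cons.mp hy with rfl | hy
    · exact hR _ _ h
    · exact ih hy

theorem PresentsConfig.size_le {q : ℕ} {W : Finset ℕ} {s : {v : ℕ // v ∈ W} → Fin q} {x : Data}
    (hx : PresentsConfig s x) : x.size ≤ 1 + W.card * 4 := by
  have := PresentsAll.size_le (B := 3) hx (by
    rintro a y ⟨u, v, rfl, rfl, rfl⟩
    simp [Data.size])
  simpa using this

namespace SpinSystem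

variable {q : ℕ} (S : SpinSystem q)

theorem pow_card_le_size {e : Finset ℕ} (he : e ∈ S.E) : q ^ e.card ≤ S.size :=
  Finset.single_le_sum (f := fun e : Finset ℕ => q ^ e.card) (fun _ _ => Nat.zero_le _) he

theorem card_edge_le_size {e : Finset ℕ} (he : e ∈ S.E) : e.card ≤ S.size :=
  (Nat.lt_pow_self S.two_le).le.trans (S.pow_card_le_size he)

theorem card_E_le_size : S.E.card ≤ S.size := by
  rw [size, Finset.card_eq_sum_ones]
  exact Finset.sum_le_sum fun e _ => Nat.one_le_pow _ _ (by have := S.two_le; omega)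

/-- Without isolated spins the hyperedges cover `V`, and `|e| ≤ q ^ |e|`. -/
theorem card_V_le_size : S.V.card ≤ S.size := by
  have h : S.V ⊆ S.E.biUnion id := fun v hv => by
    simpa using S.not_isolated v hv
  refine (Finset.card_le_card h).trans (Finset.card_biUnion_le.trans ?_)
  exact Finset.sum_le_sum fun e _ => (Nat.lt_pow_self S.two_le).le

variable {S}

/-- At most `|S|` hyperedges, each with a table of at most `|S|` rows, each row of size linear in
`|S|`: a cubic bound. It converts costs in the size of presentations into costs in `|S|`. -/
theorem Presents.size_le {x : Data} (hx : S.Presents x) :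
    x.size ≤ (Polynomial.eval S.size
      (7 + 2 * .X + .X * (4 + 2 * .X + .X * (4 + 4 * .X)) : Polynomial ℕ)) := by
  obtain ⟨xV, xE, hV, hE, rfl⟩ := hx
  have h1 := hV.size_le (B := 1) (by rintro a y rfl; simp [Data.size])
  have h2 := hE.size_le (B := 3 + 2 * S.size + S.size * (4 + 4 * S.size)) (by
    rintro ⟨e, he⟩ y ⟨u, w, hu, hw, rfl⟩
    have h3 := hu.size_le (B := 1) (by rintro a y rfl; simp [Data.size])
    have h4 := PresentsAll.size_le (B := 3 + 4 * S.size) hw (by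
      rintro a y ⟨u, v, hu, rfl, rfl⟩
      have h5 : u.size ≤ 1 + e.card * 4 := PresentsConfig.size_le hu
      have := S.card_edge_le_size he
      simp only [Data.size]
      omega)
    have h5 := S.card_edge_le_size he
    have h6 := S.pow_card_le_size he
    simp only [Fintype.card_coe, Fintype.card_fun, Fintype.card_fin] at h3 h4
    have h7 : q ^ e.card * (3 + 4 * S.size + 1) ≤ S.size * (4 + 4 * S.size) :=
      Nat.mul_le_mul h6 (by omega)
    simp only [Data.size]
    linarith)
  have h3 := S.card_V_le_size
  have h4 := S.card_E_le_size
  simp only [Fintype.card_coe] at h1 h2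
  have h5 : S.E.card * (3 + 2 * S.size + S.size * (4 + 4 * S.size) + 1) ≤
      S.size * (4 + 2 * S.size + S.size * (4 + 4 * S.size)) :=
    Nat.mul_le_mul h4 (by omega)
  simp only [Data.ofList, Data.size, Polynomial.eval_add, Polynomial.eval_mul, Polynomial.eval_X,
    Polynomial.eval_ofNat]
  linarith

end SpinSystem

/-! ### The algorithm for the cut-off -/

theorem PresentsAll.sum_eq {A : Type} [Fintype A] {R : A → Data → Prop} {x : Data}
    (hx : PresentsAll R x) {w : Data → Data} {f : A → ℝ} (hw : ∀ a y, R a y → w y = .real (f a)) :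
    x.sum w = .real (∑ a, f a) := by
  classical
  obtain ⟨l, ys, hl, hall, h, rfl⟩ := hx
  rw [Data.sum_eq (h.imp fun a y => hw a y), ← List.sum_toFinset f hl]
  congr 2
  ext a
  simp [hall]

/-- The sum of all values of all local interactions. -/
noncomputable def SpinSystem.totalInteraction {q : ℕ} (S : SpinSystem q) : ℝ :=
  ∑ e, ∑ r, (S.J e r : ℝ)

/-- Computes the sum of all values of all local interactions of a spin system. -/
noncomputable def totalData (x : Data) : Data :=
  x.snd.snd.fst.sum fun y => y.snd.sum Data.snd

/-- Computes the number of spins of a spin system. -/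
noncomputable def countData (x : Data) : Data :=
  x.snd.fst.sum fun _ => .real ((1 : ℚ) : ℝ)

namespace SpinSystem.Presents

variable {q : ℕ} {S : SpinSystem q} {x : Data}

theorem totalData_eq (hx : S.Presents x) : totalData x = .real S.totalInteraction := by
  obtain ⟨xV, xE, hV, hE, rfl⟩ := hx
  refine hE.sum_eq ?_
  rintro e y ⟨u, w, -, hw, rfl⟩
  refine PresentsAll.sum_eq hw ?_
  rintro r y ⟨u, v, -, rfl, rfl⟩
  rfl

theorem countData_eq (hx : S.Presents x) : countData x = .real (S.V.card : ℝ) := by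
  obtain ⟨xV, xE, hV, hE, rfl⟩ := hx
  have := hV.sum_eq (w := fun _ => .real ((1 : ℚ) : ℝ)) (f := fun _ => (1 : ℝ)) (by simp)
  simpa [countData, Data.ofList] using this

end SpinSystem.Presents

theorem PolyFun.totalData {F : Data → Data} (hF : PolyFun F) :
    PolyFun fun x => totalData (F x) :=
  sum (sum (PolyFun.id.snd) PolyFun.id.snd |>.comp PolyFun.id) hF.snd.snd.fst

theorem PolyFun.countData {F : Data → Data} (hF : PolyFun F) :
    PolyFun fun x => countData (F x) :=
  sum (const 1) hF.snd.fst

/-- The cut-off as a function of the total interaction `J`, the number `n` of spins of the source,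
the inverse temperature and the error parameter. -/
noncomputable def cutoffValue (q : ℕ) (J n β ε : ℝ) : ℝ :=
  J + (n * Real.log q + Real.log (1 + 2 / ε)) / β

/-- Computes `cutoffValue` from presentations of `[T, β, ε]` and of the source. -/
noncomputable def cutoffData (q : ℕ) (x : Data) : Data :=
  Op.add.apply (.cons (totalData x.fst.fst)
    (Op.div.apply (.cons
      (Op.add.apply (.cons
        (Op.mul.apply (.cons (countData x.snd) (Op.log.apply (.real ((q : ℚ) : ℝ)))))
        (Op.log.apply (Op.add.apply (.cons (.real ((1 : ℚ) : ℝ))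
          (Op.div.apply (.cons (.real ((2 : ℚ) : ℝ)) x.fst.snd.snd.fst)))))))
      x.fst.snd.fst)))

theorem cutoffData_eq {q q' : ℕ} {T : SpinSystem q'} {S : SpinSystem q} {xT xS : Data} {β ε : ℝ}
    (hT : T.Presents xT) (hS : S.Presents xS) :
    cutoffData q (.cons (Data.ofList [xT, .real β, .real ε]) xS) =
      .real (cutoffValue q T.totalInteraction S.V.card β ε) := by
  simp [cutoffData, Data.ofList, hT.totalData_eq, hS.countData_eq, Op.apply, cutoffValue]

theorem PolyFun.cutoffData (q : ℕ) {F : Data → Data} (hF : PolyFun F) :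
    PolyFun fun x => cutoffData q (F x) :=
  op_comp .add ((hF.fst.fst.totalData).pair (op_comp .div (pair
    (op_comp .add (pair (op_comp .mul (hF.snd.countData.pair (op_comp .log (const q))))
      (op_comp .log (op_comp .add ((const 1).pair
        (op_comp .div ((const 2).pair hF.fst.snd.snd.fst)))))))
    hF.fst.snd.fst)))

/-! ### The algorithm for decoding -/

/-- Ordered tuples of states, unlike graphs, have exactly one presentation. Hence comparing
presentations decides equality, and tuples can serve as lookup keys for the table of `dec`. -/
theorem presentsTuple_state_iff {q k : ℕ} (f : Fin k → Fin q) (x : Data) :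
    PresentsTuple PresentsState f x ↔
      x = Data.ofList ((List.ofFn fun i => ((f i : ℕ) : ℝ)).map .real) := by
  have h : ∀ (l : List (Fin q)) (ys : List Data), List.Forall₂ PresentsState l ys ↔
      ys = l.map fun a : Fin q => Data.real ((a.1 : ℕ) : ℝ) := by
    intro l
    induction l with
    | nil => simp
    | cons a l ih =>
      intro ys
      cases ys <;> simp [ih, PresentsState]
  simp only [PresentsTuple, h, List.map_ofFn]
  simp [Function.comp_def]

theorem PresentsTuple.map {A B : Type} {R : A → Data → Prop} {R' : B → Data → Prop} {k : ℕ}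
    {f : Fin k → A} {x : Data} (hx : PresentsTuple R f x) {h : A → B} {g : Data → Data}
    {env : Data} (hg : ∀ a y, R a y → R' (h a) (g (.cons env y))) :
    PresentsTuple R' (fun i => h (f i)) (Data.map g env x) := by
  obtain ⟨ys, hys, rfl⟩ := hx
  refine ⟨_, ?_, Data.map_ofList g env ys⟩
  have : (List.ofFn fun i => h (f i)) = (List.ofFn f).map h := by simp [Function.comp_def]
  rw [this, List.forall₂_map_left_iff, List.forall₂_map_right_iff]
  exact hys.imp fun a y => hg a y

theorem PresentsAll.map {A : Type} {R R' : A → Data → Prop}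
    {x : Data} (hx : PresentsAll R x) {g : Data → Data}
    {env : Data} (hg : ∀ a y, R a y → R' a (g (.cons env y))) :
    PresentsAll R' (Data.map g env x) := by
  obtain ⟨l, ys, hl, hall, hys, rfl⟩ := hx
  refine ⟨l, _, hl, hall, ?_, Data.map_ofList g env ys⟩
  rw [List.forall₂_map_right_iff]
  exact hys.imp fun a y => hg a y

theorem realEq_spin {W : Finset ℕ} (v : {v : ℕ // v ∈ W}) (w : {v : ℕ // v ∈ W}) (u : Data)
    (hu : PresentsSpin w u) : Data.realEq (.cons (.real (v.1 : ℝ)) u) ≠ .nil ↔ v = w := by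
  subst hu
  rw [Data.realEq_ne_nil, Nat.cast_inj, Subtype.ext_iff]

theorem listEq_state {q k : ℕ} {f : Fin k → Fin q} {x : Data} (hx : PresentsTuple PresentsState f x)
    (f' : Fin k → Fin q) (u : Data) (hu : PresentsTuple PresentsState f' u) :
    Data.listEq (.cons x u) ≠ .nil ↔ f = f' := by
  rw [presentsTuple_state_iff] at hx hu
  subst hx hu
  rw [Data.listEq_ne_nil (by simp), List.ofFn_inj, funext_iff, funext_iff]
  simp [Fin.ext_iff]

/-- Decodes one entry of the graph of `P`, given presentations of a configuration and of the
simulation. -/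
noncomputable def decodeEntry (x : Data) : Data :=
  .cons x.snd.fst (Data.lookup Data.listEq
    (Data.map (fun r => Data.lookup Data.realEq r.snd r.fst) x.fst.fst x.snd.snd)
    x.fst.snd.snd.snd.snd.snd.fst)

/-- Decodes a configuration, given presentations of the configuration and of the simulation. -/
noncomputable def decodeData (x : Data) : Data :=
  Data.map decodeEntry x x.snd.snd.snd.snd.fst

theorem PolyFun.decodeData {F : Data → Data} (hF : PolyFun F) :
    PolyFun fun x => decodeData (F x) :=
  map (PolyFun.id.snd.fst.pair (lookup listEq
    (map (lookup realEq PolyFun.id.snd PolyFun.id.fst) PolyFun.id.fst.fst PolyFun.id.snd.snd)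
    PolyFun.id.fst.snd.snd.snd.snd.snd.fst)) hF hF.snd.snd.snd.snd.fst

theorem Simulation.Presents.decodeData {q q' : ℕ} {S : SpinSystem q} {T : SpinSystem q'}
    {F : Simulation S T} {xF xs : Data} (hF : F.Presents xF) {s : S.Config}
    (hs : PresentsConfig s xs) : PresentsConfig (F.decode s) (decodeData (.cons xs xF)) := by
  obtain ⟨xP, xdec, xenc, hP, hdec, -, rfl⟩ := hF
  refine PresentsAll.map hP ?_
  rintro v y ⟨u, w, hu, hw, rfl⟩
  refine ⟨u, _, hu, ?_, rfl⟩
  -- Two nested lookups: the physical spins of `v` in the graph of `s`, then the tuple so obtained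
  -- in the graph of `dec`.
  refine Data.lookup_spec (a := fun j => s (F.phys v j)) hdec (listEq_state ?_)
  refine PresentsTuple.map (h := s) hw fun a y hy => ?_
  subst hy
  exact Data.lookup_spec hs (realEq_spin a)

/-! ### Total variation distance -/

section TotalVariation

variable {A B : Type} [Fintype A] [Fintype B]

theorem tvDist_comm (p p' : A → ℝ) : tvDist p p' = tvDist p' p := by
  simp only [tvDist, abs_sub_comm]

theorem tvDist_triangle (p₁ p₂ p₃ : A → ℝ) : tvDist p₁ p₃ ≤ tvDist p₁ p₂ + tvDist p₂ p₃ := by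
  simp only [tvDist, ← mul_add, ← Finset.sum_add_distrib]
  gcongr
  exact abs_sub_le _ _ _

theorem sum_pushforward [DecidableEq B] (g : A → B) (p : A → ℝ) :
    ∑ b, pushforward g p b = ∑ a, p a :=
  Finset.sum_fiberwise _ g p

/-- The triangle inequality on each fibre of `g`; neither positivity nor normalization plays a role.
-/
theorem tvDist_pushforward_le [DecidableEq B] (g : A → B) (p p' : A → ℝ) :
    tvDist (pushforward g p) (pushforward g p') ≤ tvDist p p' := by
  simp only [tvDist, pushforward, ← Finset.sum_sub_distrib]
  gcongr
  rw [← Finset.sum_fiberwise Finset.univ g fun a => |p a - p' a|]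
  exact Finset.sum_le_sum fun b _ => Finset.abs_sum_le_sum_abs _ _

theorem pushforward_mem_stdSimplex [DecidableEq B] (g : A → B) {p : A → ℝ}
    (hp : p ∈ stdSimplex ℝ A) : pushforward g p ∈ stdSimplex ℝ B :=
  ⟨fun _ => Finset.sum_nonneg fun a _ => hp.1 a, by rw [sum_pushforward, hp.2]⟩

theorem tvDist_normalize_le {w r : A → ℝ} (hw : ∀ a, 0 ≤ w a) (hr : ∀ a, 0 ≤ r a)
    (hW : 0 < ∑ a, w a) :
    tvDist (fun a => (w a + r a) / ∑ a, (w a + r a)) (fun a => w a / ∑ a, w a) ≤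
      (∑ a, r a) / ∑ a, w a := by
  rw [Finset.sum_add_distrib]
  have hR : 0 ≤ ∑ a, r a := Finset.sum_nonneg fun a _ => hr a
  generalize hWd : ∑ a, w a = W at *
  generalize hRd : ∑ a, r a = R at *
  -- Each of the two terms on the right sums to `R / W`, and the factor `1 / 2` in the total
  -- variation distance absorbs the doubling.
  have key : ∀ a, |(w a + r a) / (W + R) - w a / W| ≤ r a / W + (R / W) * (w a / W) := by
    intro a
    have e : (w a + r a) / (W + R) - w a / W = (W / (W + R)) * (r a / W - (R / W) * (w a / W)) := by
      field_simp
      ring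
    have h1 : 0 ≤ r a / W := div_nonneg (hr a) hW.le
    have h2 : 0 ≤ (R / W) * (w a / W) := by have := hw a; positivity
    have h3 : W / (W + R) ≤ 1 := div_le_one_of_le₀ (by linarith) (by linarith)
    rw [e, abs_mul, abs_of_nonneg (by positivity)]
    calc _ ≤ 1 * |r a / W - (R / W) * (w a / W)| := by gcongr
      _ ≤ _ := by
        rw [one_mul, abs_le]
        constructor <;> linarith
  calc tvDist _ _ ≤ (1 / 2) * ∑ a, (r a / W + (R / W) * (w a / W)) := by
        unfold tvDist
        gcongr with a
        exact key a
    _ = R / W := by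
        rw [Finset.sum_add_distrib, ← Finset.mul_sum, ← Finset.sum_div, ← Finset.sum_div, hWd, hRd]
        field_simp
        ring

end TotalVariation

/-! ### Accuracy of simulations -/

namespace SpinSystem

variable {q : ℕ} (S : SpinSystem q)

instance : Nonempty S.Config := ⟨fun _ => ⟨0, by have := S.two_le; omega⟩⟩

theorem partitionFunction_pos (β : ℝ) : 0 < S.partitionFunction β :=
  Finset.sum_pos (fun _ _ => Real.exp_pos _) Finset.univ_nonempty

end SpinSystem

namespace Simulation

variable {q q' : ℕ} {S : SpinSystem q} {T : SpinSystem q'} (F : Simulation S T)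

/-- The set of all source configurations that simulate `t`. -/
def simUnion (t : T.Config) : Set S.Config :=
  ⋃ i, simSet S T F.coding F.cutoff F.shift F.phys i t

theorem decode_of_mem {s : S.Config} {t : T.Config} (h : s ∈ F.simUnion t) : F.decode s = t := by
  obtain ⟨i, hi⟩ := Set.mem_iUnion.mp h
  funext v
  rw [decode, hi.1 v, F.coding.dec_enc]

theorem energy_of_mem {s : S.Config} {t : T.Config} (h : s ∈ F.simUnion t) :
    S.hamiltonian s - F.shift = T.hamiltonian t := by
  obtain ⟨i, hi⟩ := Set.mem_iUnion.mp h
  exact F.energy_below i t s hi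

/-- A configuration can simulate only its own decoding, so failing that it simulates nothing and
`energy_above` applies. -/
theorem cutoff_le_of_notMem {s : S.Config} (h : s ∉ F.simUnion (F.decode s)) :
    F.cutoff ≤ S.hamiltonian s - F.shift := by
  refine F.energy_above s fun i t hs => h ?_
  have : s ∈ F.simUnion t := Set.mem_iUnion.mpr ⟨i, hs⟩
  rwa [F.decode_of_mem this]

/-- All target configurations below the cut-off are simulated by the same number of source
configurations. -/
theorem exists_ncard_simUnion : ∃ N : ℕ, 0 < N ∧
    ∀ t, T.hamiltonian t < F.cutoff → (F.simUnion t).ncard = N := by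
  -- Without spins the condition on the encodings is void, all the sets of simulating configurations
  -- coincide, and the count is `d`. With a spin `v`, different encodings differ at `v`, the sets
  -- are disjoint, and the count is `m * d`.
  rcases isEmpty_or_nonempty {v : ℕ // v ∈ T.V} with hV | ⟨⟨v⟩⟩
  · refine ⟨F.degeneracy, F.degeneracy_pos, fun t ht => ?_⟩
    have : F.simUnion t =
        simSet S T F.coding F.cutoff F.shift F.phys ⟨0, F.coding.card_pos⟩ t := by
      ext s
      simp only [simUnion, Set.mem_iUnion, simSet, Set.mem_ofPred_eq, IsEmpty.forall_iff, true_and]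
      exact ⟨fun ⟨_, h⟩ => h, fun h => ⟨⟨0, F.coding.card_pos⟩, h⟩⟩
    rw [this, F.constant_degeneracy _ t ht]
  · refine ⟨F.coding.card * F.degeneracy, Nat.mul_pos F.coding.card_pos F.degeneracy_pos,
      fun t ht => ?_⟩
    have hd : Pairwise (Function.onFun Disjoint fun i =>
        simSet S T F.coding F.cutoff F.shift F.phys i t) := by
      intro i j hij
      refine Set.disjoint_left.mpr fun s hi hj => hij ?_
      exact F.coding.enc_disjoint i j (t v) ((hi.1 v).symm.trans (hj.1 v))
    rw [simUnion, Set.ncard_iUnion_of_finite (fun _ => Set.toFinite _) hd]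
    simp [F.constant_degeneracy _ t ht, finsum_eq_sum_of_fintype]

theorem tvDist_distribution_le {β H : ℝ} (hβ : 0 < β) (hH : ∀ t, T.hamiltonian t ≤ H)
    (hc : H < F.cutoff) :
    tvDist (F.distribution β) (T.boltzmann β) ≤
      (q : ℝ) ^ S.V.card * Real.exp (-β * (F.cutoff - H)) := by
  classical
  obtain ⟨N, hN, hcard⟩ := F.exists_ncard_simUnion
  -- Shifted weights: the common factor disappears in the Boltzmann distribution. On each fibre of
  -- decoding they split into `w`, the exact target weight times `N`, and the error `r`.
  let wt : S.Config → ℝ := fun s => Real.exp (-β * (S.hamiltonian s - F.shift))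
  let w : T.Config → ℝ := fun t => N * Real.exp (-β * T.hamiltonian t)
  let r : T.Config → ℝ := fun t =>
    ∑ s : S.Config with F.decode s = t, if s ∈ F.simUnion t then 0 else wt s
  have hwt : ∀ t, ∑ s : S.Config with F.decode s = t, wt s = w t + r t := by
    intro t
    have h1 : ∀ s : S.Config, wt s = (if s ∈ F.simUnion t then Real.exp (-β * T.hamiltonian t)
        else 0) + if s ∈ F.simUnion t then 0 else wt s := by
      intro s
      split_ifs with h
      · simp only [wt, F.energy_of_mem h, add_zero]
      · simp
    rw [Finset.sum_congr rfl fun s _ => h1 s, Finset.sum_add_distrib]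
    congr 1
    rw [← Finset.sum_filter, Finset.filter_filter, Finset.sum_const, nsmul_eq_mul]
    congr 2
    rw [← hcard t ((hH t).trans_lt hc), Set.ncard_eq_toFinset_card']
    congr 1
    ext s
    simpa using fun h => F.decode_of_mem h
  have hZ : ∀ s, S.boltzmann β s = wt s / ∑ s, wt s := by
    intro s
    have e : ∀ s, Real.exp (-β * S.hamiltonian s) = Real.exp (-β * F.shift) * wt s := by
      intro s
      rw [← Real.exp_add]
      ring_nf
    rw [SpinSystem.boltzmann, SpinSystem.partitionFunction]
    simp only [e]
    rw [← Finset.mul_sum, mul_div_mul_left _ _ (Real.exp_pos _).ne']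
  have hF : F.distribution β = fun t => (w t + r t) / ∑ t, (w t + r t) := by
    funext t
    rw [distribution, pushforward, Finset.sum_congr rfl fun s _ => hZ s, ← Finset.sum_div, hwt]
    congr 1
    rw [← Finset.sum_congr rfl fun t _ => hwt t]
    exact (Finset.sum_fiberwise _ F.decode wt).symm
  have hN' : (0 : ℝ) < N := by exact_mod_cast hN
  have hT : T.boltzmann β = fun t => w t / ∑ t, w t := by
    funext t
    simp only [w]
    rw [← Finset.mul_sum, mul_div_mul_left _ _ hN'.ne']
    rfl
  have hr : ∀ t, 0 ≤ r t := fun t => Finset.sum_nonneg fun s _ => by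
    split_ifs
    · exact le_rfl
    · exact (Real.exp_pos _).le
  have hw : ∀ t, 0 ≤ w t := fun t => by positivity
  have hW : Real.exp (-β * H) ≤ ∑ t, w t := by
    obtain ⟨t⟩ : Nonempty T.Config := inferInstance
    refine le_trans ?_ (Finset.single_le_sum (fun t _ => hw t) (Finset.mem_univ t))
    have h1 : (1 : ℝ) ≤ N := by exact_mod_cast hN
    have h2 : Real.exp (-β * H) ≤ Real.exp (-β * T.hamiltonian t) := by
      rw [Real.exp_le_exp]
      nlinarith [hH t]
    simp only [w]
    nlinarith [Real.exp_pos (-β * T.hamiltonian t)]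
  -- The fibres of decoding partition the `q ^ |V_S|` source configurations, and each contributes at
  -- most `e^{-βΔ}`.
  have hR : ∑ t, r t ≤ (q : ℝ) ^ S.V.card * Real.exp (-β * F.cutoff) := by
    have h1 : ∀ t, r t ≤ ∑ s : S.Config with F.decode s = t, Real.exp (-β * F.cutoff) := by
      intro t
      refine Finset.sum_le_sum fun s hs => ?_
      split_ifs with h
      · exact (Real.exp_pos _).le
      · obtain rfl : F.decode s = t := by simpa using hs
        rw [Real.exp_le_exp]
        nlinarith [F.cutoff_le_of_notMem h]
    refine (Finset.sum_le_sum fun t _ => h1 t).trans_eq ?_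
    rw [Finset.sum_fiberwise Finset.univ F.decode fun _ => Real.exp (-β * F.cutoff)]
    simp
  rw [hF, hT]
  refine (tvDist_normalize_le hw hr ((Real.exp_pos _).trans_le hW)).trans ?_
  calc _ ≤ ((q : ℝ) ^ S.V.card * Real.exp (-β * F.cutoff)) / Real.exp (-β * H) := by
        gcongr
    _ = _ := by
        rw [mul_div_assoc, ← Real.exp_sub]
        ring_nf

end Simulation

/-! ### The reduction -/

/-- Each hyperedge contributes one entry of its table, and the others are nonnegative. The bound is
crude, but it avoids maximizing over exponentially many configurations. -/
theorem SpinSystem.hamiltonian_le_totalInteraction {q : ℕ} (S : SpinSystem q) (s : S.Config) :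
    S.hamiltonian s ≤ S.totalInteraction :=
  Finset.sum_le_sum fun e _ => Finset.single_le_sum (f := fun r => (S.J e r : ℝ))
    (fun _ _ => NNReal.coe_nonneg _) (Finset.mem_univ _)

theorem SpinSystem.totalInteraction_nonneg {q : ℕ} (S : SpinSystem q) : 0 ≤ S.totalInteraction :=
  Finset.sum_nonneg fun _ _ => Finset.sum_nonneg fun _ _ => NNReal.coe_nonneg _

/-- The summand `1` in `1 + 2 / ε` keeps the logarithm positive even for large `ε`. -/
theorem lt_cutoffValue (q : ℕ) (J : ℝ) (n : ℕ) {β ε : ℝ} (hβ : 0 < β) (hε : 0 < ε) :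
    J < cutoffValue q J n β ε := by
  have h1 : 0 ≤ Real.log q := Real.log_natCast_nonneg q
  have h2 : 0 < Real.log (1 + 2 / ε) := Real.log_pos (by have := div_pos two_pos hε; linarith)
  have : 0 < (n * Real.log q + Real.log (1 + 2 / ε)) / β := by positivity
  rw [cutoffValue]
  linarith

/-- The term `n log q` cancels `q ^ n`, leaving `1 / (1 + 2 / ε) = ε / (ε + 2)`. -/
theorem pow_mul_exp_cutoffValue_lt {q : ℕ} (hq : 2 ≤ q) (J : ℝ) (n : ℕ) {β ε : ℝ} (hβ : 0 < β)
    (hε : 0 < ε) : (q : ℝ) ^ n * Real.exp (-β * (cutoffValue q J n β ε - J)) < ε / 2 := by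
  have hq' : (0 : ℝ) < q := by exact_mod_cast (by omega : 0 < q)
  have h1 : (0 : ℝ) < 1 + 2 / ε := by positivity
  have e : -β * (cutoffValue q J n β ε - J) = -(n * Real.log q) - Real.log (1 + 2 / ε) := by
    rw [cutoffValue]
    field_simp
    ring
  rw [e, Real.exp_sub, Real.exp_log h1, Real.exp_neg, ← Real.log_pow, Real.exp_log (by positivity),
    mul_div_assoc', mul_inv_cancel₀ (by positivity), div_lt_iff₀ h1]
  field_simp
  linarith

namespace Emulation

variable {M M' : SpinModel} (Emu : Emulation M M')

/-- The number of spins of the source, which does not depend on the cut-off. -/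
def sourceCard (T : M'.Sys) : ℕ := (Emu.source T ⟨1, one_pos⟩).1.V.card

/-- Uniformity of the emulation breaks a circle: the cut-off depends on the number of source spins,
while the source depends on the cut-off. -/
theorem sourceCard_eq (T : M'.Sys) (δ : PosReal) : (Emu.source T δ).1.V.card = Emu.sourceCard T := by
  rw [sourceCard, Emu.uniform_V T δ]

/-- The cut-off that achieves accuracy `ε / 2` at inverse temperature `β`. -/
noncomputable def samplingCutoff (I : AspInstance M') (ε : PosReal) : PosReal :=
  ⟨cutoffValue M.q I.1.1.totalInteraction (Emu.sourceCard I.1) I.2.1 ε.1,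
    I.1.1.totalInteraction_nonneg.trans_lt
      (lt_cutoffValue _ _ _ I.2.2 ε.2)⟩

theorem tvDist_samplingCutoff_lt (T : M'.Sys) (β ε : PosReal) :
    tvDist ((Emu.sim T (Emu.samplingCutoff (T, β) ε)).distribution β.1) (T.1.boltzmann β.1) <
      ε.1 / 2 := by
  have hq := (Emu.source T ⟨1, one_pos⟩).1.two_le
  have hc := Emu.cutoff_eq T (Emu.samplingCutoff (T, β) ε)
  have h := (Emu.sim T (Emu.samplingCutoff (T, β) ε)).tvDist_distribution_le β.2
    T.1.hamiltonian_le_totalInteraction (by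
      rw [hc]
      exact lt_cutoffValue _ _ _ β.2 ε.2)
  rw [hc, Emu.sourceCard_eq] at h
  exact h.trans_lt (pow_mul_exp_cutoffValue_lt hq _ _ β.2 ε.2)

/-- The emulation can be run with the cut-off `samplingCutoff`, while keeping the input. -/
theorem run_samplingCutoff {ι : Type} (r : ι → AspInstance M' × PosReal) (size : ι → ℕ)
    (hr : ∀ i, (r i).1.1.1.size ≤ size i) {inp : ι → Data → Prop} (c : Polynomial ℕ)
    (hc : ∀ i x, inp i x → x.size ≤ c.eval (size i)) {H : Data → Data} (hH : PolyFun H)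
    (hinp : ∀ i x, inp i x → ∃ xT, (r i).1.1.1.Presents xT ∧
      H x = Data.ofList [xT, .real (r i).1.2.1, .real (r i).2.1]) :
    PolyTimeComputable size inp fun i y => ∃ x yS yF, inp i x ∧
      (Emu.source (r i).1.1 (Emu.samplingCutoff (r i).1 (r i).2)).1.Presents yS ∧
      (Emu.sim (r i).1.1 (Emu.samplingCutoff (r i).1 (r i).2)).Presents yF ∧
      y = .cons x (.cons yS yF) := by
  -- Trial run with the arbitrary cut-off `1`, used only to count the spins of the source.
  have run₁ := (Emu.polytime.reindex (fun i => ((r i).1.1, (⟨1, one_pos⟩ : PosReal))) size hr).keep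
    (hH.fst.pair (PolyFun.const 1)) c hc (by
      intro i x hx
      obtain ⟨xT, hT, e⟩ := hinp i x hx
      exact ⟨xT, hT, by simp [e, Data.ofList]⟩)
  obtain ⟨b, run₁⟩ := run₁.bounded
  -- Second run, with the computed cut-off. Its time bound involves `|T|` only, however large the
  -- cut-off is.
  have run₂ := (Emu.polytime.reindex (fun i => ((r i).1.1, Emu.samplingCutoff (r i).1 (r i).2))
    size hr).keep (inp := fun i y => (∃ x z, inp i x ∧ (∃ yS yF : Data,
        (Emu.source (r i).1.1 ⟨1, one_pos⟩).1.Presents yS ∧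
        (Emu.sim (r i).1.1 ⟨1, one_pos⟩).Presents yF ∧ z = .cons yS yF) ∧ y = .cons x z) ∧
        y.size ≤ b.eval (size i))
    (F := fun y => .cons (H y.fst).fst (cutoffData M.q (.cons (H y.fst) y.snd.fst)))
    ((hH.comp PolyFun.id.fst).fst.pair
      (((hH.comp PolyFun.id.fst).pair PolyFun.id.snd.fst).cutoffData M.q)) b
    (fun i y hy => hy.2) (by
      rintro i _ ⟨⟨x, _, hx, ⟨yS, yF, hS, -, rfl⟩, rfl⟩, -⟩
      obtain ⟨xT, hT, e⟩ := hinp i x hx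
      refine ⟨xT, hT, ?_⟩
      simp only [Data.fst_cons, Data.snd_cons, e, cutoffData_eq hT hS]
      rfl)
  obtain ⟨d, run⟩ := (run₂.comp run₁).bounded
  refine .comp (.of_polyFun (F := fun y => .cons y.fst.fst y.snd)
    (PolyFun.id.fst.fst.pair PolyFun.id.snd) d (fun i y hy => hy.2) ?_) run
  rintro i _ ⟨⟨_, _, ⟨⟨x, z, hx, -, rfl⟩, -⟩, ⟨yS, yF, hS, hF, rfl⟩, rfl⟩, -⟩
  exact ⟨x, yS, yF, hx, hS, hF, rfl⟩

theorem instanceMap_polytime : PolyTimeComputable (ι := AspInstance M' × PosReal)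
    (fun i => i.1.1.1.size)
    (fun i x => ∃ xT : Data, i.1.1.1.Presents xT ∧
      x = Data.ofList [xT, .real i.1.2.1, .real i.2.1])
    (fun i y => ∃ yS : Data, (Emu.instanceMap Emu.samplingCutoff i.1 i.2).1.1.Presents yS ∧
      y = Data.ofList [yS, .real (Emu.instanceMap Emu.samplingCutoff i.1 i.2).2.1]) := by
  obtain ⟨d, run⟩ := (Emu.run_samplingCutoff (fun i => i) (fun i => i.1.1.1.size) (fun _ => le_rfl)
    -- The constant `6` counts the nodes of the three-entry list besides the presentation of `T`.
    (6 + (7 + 2 * .X + .X * (4 + 2 * .X + .X * (4 + 4 * .X))) : Polynomial ℕ) (by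
      rintro i _ ⟨xT, hT, rfl⟩
      have := hT.size_le
      rw [Polynomial.eval_add, Polynomial.eval_ofNat]
      simp only [Data.ofList, Data.size]
      omega)
    PolyFun.id fun i x h => h).bounded
  refine .comp (.of_polyFun (F := fun y => .cons y.snd.fst (.cons y.fst.snd.fst .nil))
    (PolyFun.id.snd.fst.pair (PolyFun.id.fst.snd.fst.pair PolyFun.nil)) d (fun i y hy => hy.2) ?_)
    run
  rintro i _ ⟨⟨_, yS, yF, ⟨xT, hT, rfl⟩, hS, hF, rfl⟩, -⟩
  exact ⟨yS, hS, rfl⟩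

/-- The input contains no simulation, so the emulation is run again with the same cut-off to recover
`P` and `dec`; the sample `z` is carried along unchanged. -/
theorem sampleMap_polytime : PolyTimeComputable
    (ι := Σ i : AspInstance M' × PosReal,
      (Emu.instanceMap Emu.samplingCutoff i.1 i.2).1.1.Config)
    (fun i => i.1.1.1.1.size + (Emu.instanceMap Emu.samplingCutoff i.1.1 i.1.2).1.1.V.card)
    (fun i x => ∃ xT xz : Data, i.1.1.1.1.Presents xT ∧ PresentsConfig i.2 xz ∧
      x = Data.ofList [xT, .real i.1.1.2.1, xz, .real i.1.2.1])
    (fun i y => PresentsConfig (Emu.sampleMap Emu.samplingCutoff i.1.1 i.1.2 i.2) y) := by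
  obtain ⟨d, run⟩ := (Emu.run_samplingCutoff (fun i : Σ i : AspInstance M' × PosReal,
      (Emu.instanceMap Emu.samplingCutoff i.1 i.2).1.1.Config => i.1)
    (fun i => i.1.1.1.1.size + (Emu.instanceMap Emu.samplingCutoff i.1.1 i.1.2).1.1.V.card)
    (fun _ => Nat.le_add_right _ _)
    (8 + 4 * .X + (7 + 2 * .X + .X * (4 + 2 * .X + .X * (4 + 4 * .X))) : Polynomial ℕ)
    (inp := fun i x => ∃ xT xz : Data, i.1.1.1.1.Presents xT ∧ PresentsConfig i.2 xz ∧
      x = Data.ofList [xT, .real i.1.1.2.1, xz, .real i.1.2.1]) (by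
      rintro i _ ⟨xT, xz, hT, hz, rfl⟩
      have h1 := hT.size_le.trans (eval_mono _ (Nat.le_add_right _
        (Emu.instanceMap Emu.samplingCutoff i.1.1 i.1.2).1.1.V.card))
      have h2 := hz.size_le
      rw [Polynomial.eval_add]
      refine le_trans ?_ (Nat.add_le_add_left h1 _)
      simp only [Data.ofList, Data.size, Polynomial.eval_add, Polynomial.eval_mul,
        Polynomial.eval_X, Polynomial.eval_ofNat]
      omega)
    (H := fun x => .cons x.fst (.cons x.snd.fst x.snd.snd.snd))
    (PolyFun.id.fst.pair (PolyFun.id.snd.fst.pair PolyFun.id.snd.snd.snd)) (by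
      rintro i _ ⟨xT, xz, hT, hz, rfl⟩
      exact ⟨xT, hT, rfl⟩)).bounded
  refine .comp (.of_polyFun (F := fun y => decodeData (.cons y.fst.snd.snd.fst y.snd.snd))
    ((PolyFun.id.fst.snd.snd.fst.pair PolyFun.id.snd.snd).decodeData) d (fun i y hy => hy.2) ?_) run
  rintro i _ ⟨⟨_, yS, yF, ⟨xT, xz, hT, hz, rfl⟩, hS, hF, rfl⟩, -⟩
  exact hF.decodeData hz

theorem halfError_polytime : PolyTimeComputable (ι := PosReal) (fun _ => 1)
    (fun ε x => x = .real ε.1) (fun ε y => y = .real (halfError ε).1) := by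
  refine .of_polyFun (F := fun x => Op.div.apply (.cons x (.real ((2 : ℚ) : ℝ))))
    (.op_comp .div (PolyFun.id.pair (.const 2))) 1 ?_ ?_
  · rintro ε _ rfl
    simp [Data.size]
  · rintro ε _ rfl
    simp [Op.apply, halfError]

theorem isPTASReduction : IsPTASReduction M' M (Emu.instanceMap Emu.samplingCutoff)
    (Emu.sampleMap Emu.samplingCutoff) halfError := by
  refine ⟨Emu.instanceMap_polytime, Emu.sampleMap_polytime, halfError_polytime, ?_⟩
  rintro ⟨T, β⟩ ε p ⟨hp, hd⟩
  refine ⟨pushforward_mem_stdSimplex _ hp, ?_⟩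
  have h1 := Emu.tvDist_samplingCutoff_lt T β ε
  rw [tvDist_comm] at h1
  -- Half of the error comes from the simulation, the other half from the sampler after decoding.
  exact (tvDist_triangle _ _ _).trans_lt
    ((add_lt_add h1 ((tvDist_pushforward_le _ _ _).trans_lt hd)).trans_eq (add_halves ε.1))

end Emulation

end SpinEmulation

theorem mainTheorem7 (M M' : SpinEmulation.SpinModel) (Emu : SpinEmulation.Emulation M M') :
    ∃ δ : SpinEmulation.AspInstance M' → SpinEmulation.PosReal → SpinEmulation.PosReal,
      SpinEmulation.IsPTASReduction M' M (Emu.instanceMap δ) (Emu.sampleMap δ)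
        SpinEmulation.halfError ∧
      ∀ (T : M'.Sys) (β ε : SpinEmulation.PosReal),
        SpinEmulation.tvDist ((Emu.sim T (δ (T, β) ε)).distribution β.1) (T.1.boltzmann β.1)
          < ε.1 / 2 ∧
        ∀ p ∈ stdSimplex ℝ (Emu.source T (δ (T, β) ε)).1.Config,
          SpinEmulation.tvDist
              (SpinEmulation.pushforward (Emu.sim T (δ (T, β) ε)).decode p)
              ((Emu.sim T (δ (T, β) ε)).distribution β.1)
            ≤ SpinEmulation.tvDist p ((Emu.source T (δ (T, β) ε)).1.boltzmann β.1) := by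
  exact ⟨Emu.samplingCutoff, Emu.isPTASReduction, fun T β ε =>
    ⟨Emu.tvDist_samplingCutoff_lt T β ε, fun _ _ => SpinEmulation.tvDist_pushforward_le _ _ _⟩⟩
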